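/- Let $\kappa>0$ and $D_\kappa=\pi/\sqrt{\kappa}$. Let $(M,d)$ be a complete $\mathrm{CAT}(\kappa)$ space, that is, a complete metric space in which any two points at distance less than $D_\kappa$ are joined by a geodesic and every geodesic triangle of perimeter less than $2D_\kappa$ satisfies the $\mathrm{CAT}(\kappa)$ comparison inequality with respect to the $2$-sphere of constant curvature $\kappa$. Assume that $\operatorname{diam}(M)<D_\kappa/2$. Let $A,B\subseteq M$ be closed convex sets with $A\cap B\neq\emptyset$, where a set $C$ is convex if any two points of $C$ are joined by a geodesic in $M$ and every such geodesic is contained in $C$. For a non-empty closed convex set $C$ let $P_C\colon M\to C$ be the metric projection, so that $P_C(x)$ is the unique point of $C$ with $d(x,P_C(x))=\inf_{c\in C}d(x,c)$. Let $x_0\in M$ be arbitrary and define $$x_{2n-1}=P_A(x_{2n-2}),\qquad x_{2n}=P_B(x_{2n-1})\qquad(n\ge 1).$$ If $A$ or $B$ is boundedly compact (each of its bounded closed subsets is compact), then the sequence $(x_n)$ converges in the metric $d$ to a point of $A\cap B$. -/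

import Mathlib

namespace CATSpace

/-- `D_κ = π / √κ`, the diameter of the model sphere of curvature `κ > 0`. -/
noncomputable def modelDiam (κ : ℝ) : ℝ := Real.pi / Real.sqrt κ

/-- The unit sphere `𝕊² ⊆ ℝ³`, the underlying set of the model space `M_κ²`. -/
abbrev ModelSphere : Type := Metric.sphere (0 : EuclideanSpace ℝ (Fin 3)) 1

/-- The distance of `M_κ²`: the angular distance `arccos ⟨x, y⟩ ∈ [0, π]` scaled by `1 / √κ`. -/
noncomputable def modelDist (κ : ℝ) (x y : ModelSphere) : ℝ :=
  Real.arccos (inner ℝ (x : EuclideanSpace ℝ (Fin 3)) (y : EuclideanSpace ℝ (Fin 3))) /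
    Real.sqrt κ

/-- `γ : [0, 1] → X` is a geodesic joining `x` and `y` for the distance function `δ`. The distance
is an argument so that the same notion serves a metric space (`δ = dist`) and the model space. -/
def IsGeodesic {X : Type*} (δ : X → X → ℝ) (γ : unitInterval → X) (x y : X) : Prop :=
  γ 0 = x ∧ γ 1 = y ∧ ∀ s t : unitInterval, δ (γ s) (γ t) = δ x y * |(s : ℝ) - (t : ℝ)|

/-- Three vertices `v 0, v 1, v 2`, with `γ i` a geodesic side joining `v i` and `v (i + 1)`
(indices modulo `3`). -/
def IsGeodesicTriangle {X : Type*} (δ : X → X → ℝ) (v : Fin 3 → X)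
    (γ : Fin 3 → unitInterval → X) : Prop :=
  ∀ i, IsGeodesic δ (γ i) (v i) (v (i + 1))

/-- `(w, η)` is a comparison triangle in `M_κ²` for the triangle with vertices `v`. -/
def IsComparisonTriangle {M : Type*} [MetricSpace M] (κ : ℝ) (v : Fin 3 → M)
    (w : Fin 3 → ModelSphere) (η : Fin 3 → unitInterval → ModelSphere) : Prop :=
  IsGeodesicTriangle (modelDist κ) w η ∧
    ∀ i, dist (v i) (v (i + 1)) = modelDist κ (w i) (w (i + 1))

/-- The `CAT(κ)` inequality for a geodesic triangle `(v, γ)`: for every comparison triangle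
`(w, η)`, all points `p`, `q` on the `i`-th and `j`-th sides and all comparison points `p'`, `q'`
on the corresponding sides, `d(p, q) ≤ ρ(p', q')`. -/
def SatisfiesCATInequality {M : Type*} [MetricSpace M] (κ : ℝ) (v : Fin 3 → M)
    (γ : Fin 3 → unitInterval → M) : Prop :=
  ∀ (w : Fin 3 → ModelSphere) (η : Fin 3 → unitInterval → ModelSphere),
    IsComparisonTriangle κ v w η →
    ∀ i j : Fin 3, ∀ p ∈ Set.range (γ i), ∀ q ∈ Set.range (γ j),
    ∀ p' ∈ Set.range (η i), ∀ q' ∈ Set.range (η j),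
      dist p (v i) = modelDist κ p' (w i) → dist q (v j) = modelDist κ q' (w j) →
      dist p q ≤ modelDist κ p' q'

/-- A `CAT(κ)` space (`κ > 0`): points at distance less than `D_κ` are joined by a geodesic, and
every geodesic triangle of perimeter less than `2 D_κ` satisfies the `CAT(κ)` inequality. -/
structure IsCAT (κ : ℝ) (M : Type*) [MetricSpace M] : Prop where
  exists_geodesic : ∀ x y : M, dist x y < modelDiam κ → ∃ γ, IsGeodesic dist γ x y
  cat_inequality : ∀ (v : Fin 3 → M) (γ : Fin 3 → unitInterval → M),
    IsGeodesicTriangle dist v γ → ∑ i, dist (v i) (v (i + 1)) < 2 * modelDiam κ →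
    SatisfiesCATInequality κ v γ

/-- Any two points of `C` are joined by a geodesic in `M`, and every such geodesic stays in `C`. -/
def IsGeodesicallyConvex {M : Type*} [MetricSpace M] (C : Set M) : Prop :=
  ∀ x ∈ C, ∀ y ∈ C, (∃ γ, IsGeodesic dist γ x y) ∧
    ∀ γ, IsGeodesic dist γ x y → Set.range γ ⊆ C

/-- `p` is a point of `C` with `d(x, p) = d(x, C)`. -/
def IsNearestPoint {M : Type*} [MetricSpace M] (C : Set M) (x p : M) : Prop :=
  p ∈ C ∧ dist x p = Metric.infDist x C

open Classical in
/-- The metric projection `P_C`: the unique point of `C` nearest to `x`, with the default value `x`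
where there is no such unique point. -/
noncomputable def metricProj {M : Type*} [MetricSpace M] (C : Set M) (x : M) : M :=
  if h : ∃! p, IsNearestPoint C x p then h.choose else x

/-- The alternating projection sequence started at `x₀`:
`x_{2n+1} = P_A (x_{2n})` and `x_{2n+2} = P_B (x_{2n+1})`. -/
noncomputable def altProj {M : Type*} [MetricSpace M] (A B : Set M) (x₀ : M) : ℕ → M
  | 0 => x₀
  | n + 1 => if Even n then metricProj A (altProj A B x₀ n) else metricProj B (altProj A B x₀ n)

/-- A metric space is boundedly compact if its bounded closed subsets are compact. -/
def BoundedlyCompact (X : Type*) [MetricSpace X] : Prop :=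
  ∀ S : Set X, Bornology.IsBounded S → IsClosed S → IsCompact S

end CATSpace

/-!
Rescaling distances by `√κ`, a `CAT(κ)` space behaves like the unit sphere, with
`cos (√κ * dist x y)` in place of the inner product: along a geodesic it is bounded below by its
spherical interpolation. At the midpoint of two almost nearest points of a convex set this shows
that nearest points exist; near the nearest point `p` of `x` it gives the Pythagorean inequality
`cos (√κ * dist x c) ≤ cos (√κ * dist x p) * cos (√κ * dist p c)` for every point `c` of the set.

Hence, for a common point `z` of the sets at distance less than `D_κ / 2` from the start, the
distances to `z` decrease along successive projections and the step lengths tend to zero. By the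
latter, every cluster point of an alternating projection sequence lies in both sets; by the former,
restarted at a term close enough to the cluster point, the whole sequence converges to it.
-/

namespace CATSpace

open Real Filter Topology Set
open scoped RealInnerProductSpace

section Scaling

variable {κ : ℝ}

lemma modelDiam_pos (hκ : 0 < κ) : 0 < modelDiam κ :=
  div_pos pi_pos (sqrt_pos.2 hκ)

lemma sqrt_mul_modelDiam (hκ : 0 < κ) : √κ * modelDiam κ = π :=
  mul_div_cancel₀ π (sqrt_pos.2 hκ).ne'

lemma strictAntiOn_cos_sqrt_mul (hκ : 0 < κ) :
    StrictAntiOn (fun r => cos (√κ * r)) (Icc 0 (modelDiam κ)) := by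
  have hk : 0 < √κ := sqrt_pos.2 hκ
  refine strictAntiOn_cos.comp_strictMonoOn (fun r _ s _ hrs => by gcongr) fun r hr => ?_
  refine ⟨mul_nonneg hk.le hr.1, ?_⟩
  rw [← sqrt_mul_modelDiam hκ]
  exact mul_le_mul_of_nonneg_left hr.2 hk.le

lemma cos_sqrt_mul_pos (hκ : 0 < κ) {r : ℝ} (h₀ : 0 ≤ r) (h : r < modelDiam κ / 2) :
    0 < cos (√κ * r) := by
  have hD : √κ * (modelDiam κ / 2) = π / 2 := by rw [← mul_div_assoc, sqrt_mul_modelDiam hκ]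
  rw [← cos_pi_div_two, ← hD]
  have := modelDiam_pos hκ
  exact strictAntiOn_cos_sqrt_mul hκ ⟨h₀, by linarith⟩ ⟨by linarith, by linarith⟩ h

lemma tendsto_zero_of_tendsto_cos_sqrt_mul (hκ : 0 < κ) {ι : Type*} {l : Filter ι} {f : ι → ℝ}
    (hf : ∀ i, f i ∈ Icc 0 (modelDiam κ)) (h : Tendsto (fun i => cos (√κ * f i)) l (𝓝 1)) :
    Tendsto f l (𝓝 0) := by
  have hk : 0 < √κ := sqrt_pos.2 hκ
  have harccos := ((continuous_arccos.tendsto 1).comp h).const_mul (√κ)⁻¹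
  rw [arccos_one, mul_zero] at harccos
  refine harccos.congr fun i => ?_
  have hle : √κ * f i ≤ π := by
    rw [← sqrt_mul_modelDiam hκ]
    exact mul_le_mul_of_nonneg_left (hf i).2 hk.le
  rw [Function.comp_apply, arccos_cos (mul_nonneg hk.le (hf i).1) hle, inv_mul_cancel_left₀ hk.ne']

end Scaling

section Slerp

variable {E : Type*} [NormedAddCommGroup E] [InnerProductSpace ℝ E]

/-- Spherical linear interpolation between unit vectors `u` and `v` at angle `θ`, with the junk
value `0` where `sin θ = 0`. -/
noncomputable def slerp (θ : ℝ) (u v : E) (t : ℝ) : E :=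
  (sin θ)⁻¹ • (sin ((1 - t) * θ) • u + sin (t * θ) • v)

lemma inner_slerp_slerp {θ : ℝ} (hθ : sin θ ≠ 0) {u v : E} (hu : ‖u‖ = 1) (hv : ‖v‖ = 1)
    (huv : ⟪u, v⟫ = cos θ) (s t : ℝ) :
    ⟪slerp θ u v s, slerp θ u v t⟫ = cos (s * θ - t * θ) := by
  have huu : ⟪u, u⟫ = 1 := by rw [real_inner_self_eq_norm_sq, hu, one_pow]
  have hvv : ⟪v, v⟫ = 1 := by rw [real_inner_self_eq_norm_sq, hv, one_pow]
  simp only [slerp, inner_add_left, inner_add_right, real_inner_smul_left, real_inner_smul_right,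
    huu, hvv, huv, real_inner_comm u v, sub_mul, one_mul]
  generalize s * θ = a, t * θ = b
  rw [sin_sub, sin_sub, cos_sub]
  field_simp
  linear_combination (-sin a * sin b) * sin_sq_add_cos_sq θ

lemma norm_slerp {θ : ℝ} (hθ : sin θ ≠ 0) {u v : E} (hu : ‖u‖ = 1) (hv : ‖v‖ = 1)
    (huv : ⟪u, v⟫ = cos θ) (t : ℝ) : ‖slerp θ u v t‖ = 1 := by
  rw [norm_eq_sqrt_real_inner, inner_slerp_slerp hθ hu hv huv, sub_self, cos_zero, sqrt_one]

end Slerp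

section ModelSpace

variable {κ : ℝ}

lemma modelDist_mem_Icc (κ : ℝ) (u v : ModelSphere) : modelDist κ u v ∈ Icc 0 (modelDiam κ) :=
  ⟨div_nonneg (arccos_nonneg _) (sqrt_nonneg κ),
    div_le_div_of_nonneg_right (arccos_le_pi _) (sqrt_nonneg κ)⟩

lemma modelDist_self (κ : ℝ) (u : ModelSphere) : modelDist κ u u = 0 := by
  simp [modelDist]

lemma cos_sqrt_mul_modelDist (hκ : 0 < κ) (u v : ModelSphere) :
    cos (√κ * modelDist κ u v) = ⟪u.1, v.1⟫ := by
  have hle := abs_real_inner_le_norm u.1 v.1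
  rw [norm_eq_of_mem_sphere u, norm_eq_of_mem_sphere v, mul_one, abs_le] at hle
  rw [modelDist, mul_div_cancel₀ _ (sqrt_pos.2 hκ).ne', cos_arccos hle.1 hle.2]

lemma modelDist_eq_of_inner_eq (hκ : 0 < κ) {u v : ModelSphere} {r : ℝ}
    (hr : r ∈ Icc 0 (modelDiam κ)) (h : ⟪u.1, v.1⟫ = cos (√κ * r)) : modelDist κ u v = r :=
  (strictAntiOn_cos_sqrt_mul hκ).injOn (modelDist_mem_Icc κ u v) hr <|
    (cos_sqrt_mul_modelDist hκ u v).trans h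

lemma exists_isGeodesic_modelDist (hκ : 0 < κ) {u v : ModelSphere}
    (huv : modelDist κ u v < modelDiam κ) :
    ∃ η : unitInterval → ModelSphere, IsGeodesic (modelDist κ) η u v ∧ ∀ t,
      sin (√κ * modelDist κ u v) • (η t).1 = sin ((1 - t) * (√κ * modelDist κ u v)) • u.1 +
        sin (t * (√κ * modelDist κ u v)) • v.1 := by
  have hk : 0 < √κ := sqrt_pos.2 hκ
  have hu : ‖u.1‖ = 1 := norm_eq_of_mem_sphere u
  have hv : ‖v.1‖ = 1 := norm_eq_of_mem_sphere v
  have hcos : ⟪u.1, v.1⟫ = cos (√κ * modelDist κ u v) := (cos_sqrt_mul_modelDist hκ u v).symm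
  rcases (modelDist_mem_Icc κ u v).1.eq_or_lt with h₀ | hpos
  · rw [← h₀, mul_zero, cos_zero] at hcos
    obtain rfl : u = v := Subtype.ext ((inner_eq_one_iff_of_norm_eq_one hu hv).1 hcos)
    exact ⟨fun _ => u, ⟨rfl, rfl, by simp [modelDist_self]⟩, by simp [modelDist_self]⟩
  set θ := √κ * modelDist κ u v
  have hsin : sin θ ≠ 0 := by
    refine (sin_pos_of_pos_of_lt_pi (mul_pos hk hpos) ?_).ne'
    rw [← sqrt_mul_modelDiam hκ]
    exact mul_lt_mul_of_pos_left huv hk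
  refine ⟨fun t => ⟨slerp θ u.1 v.1 t, mem_sphere_zero_iff_norm.2 (norm_slerp hsin hu hv hcos t)⟩,
    ⟨Subtype.ext ?_, Subtype.ext ?_, fun s t => modelDist_eq_of_inner_eq hκ ⟨?_, ?_⟩ ?_⟩,
    fun t => smul_inv_smul₀ hsin _⟩
  · simp [slerp, hsin]
  · simp [slerp, hsin]
  · positivity
  · refine (mul_le_of_le_one_right hpos.le ?_).trans huv.le
    exact abs_sub_le_of_le_of_le s.2.1 s.2.2 t.2.1 t.2.2 |>.trans_eq (sub_zero 1)
  · rw [inner_slerp_slerp hsin hu hv hcos, ← sub_mul, ← cos_abs, abs_mul,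
      abs_of_pos (mul_pos hk hpos), mul_comm, mul_assoc]

lemma abs_cos_sub_cos_mul_cos_le {a b c : ℝ} (hsub : |a - b| ≤ c) (hadd : c ≤ a + b)
    (hperim : a + b + c ≤ 2 * π) : |cos c - cos a * cos b| ≤ sin a * sin b := by
  have hc : 0 ≤ c := (abs_nonneg _).trans hsub
  have hupper : cos c ≤ cos (a - b) := by
    rw [← cos_abs (a - b)]
    exact cos_le_cos_of_nonneg_of_le_pi (abs_nonneg _) (by linarith) hsub
  have hlower : cos (a + b) ≤ cos c := by
    rcases le_total (a + b) π with h | h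
    · exact cos_le_cos_of_nonneg_of_le_pi hc h hadd
    · rw [← cos_two_pi_sub]
      exact cos_le_cos_of_nonneg_of_le_pi hc (by linarith) (by linarith)
  rw [cos_sub] at hupper
  rw [cos_add] at hlower
  exact abs_le.2 ⟨by linarith, by linarith⟩

lemma exists_modelSphere_inner_eq_cos {a b c : ℝ}
    (h : |cos c - cos a * cos b| ≤ |sin a * sin b|) :
    ∃ u v w : ModelSphere,
      ⟪u.1, v.1⟫ = cos a ∧ ⟪u.1, w.1⟫ = cos b ∧ ⟪v.1, w.1⟫ = cos c := by
  obtain ⟨s, hs, hsb⟩ : ∃ s, sin a * s = cos c - cos a * cos b ∧ s ^ 2 ≤ sin b ^ 2 := by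
    rcases eq_or_ne (sin a) 0 with ha | ha
    · rw [ha, zero_mul, abs_zero, abs_nonpos_iff] at h
      exact ⟨0, by rw [h, mul_zero], by simpa using sq_nonneg (sin b)⟩
    · refine ⟨(cos c - cos a * cos b) / sin a, mul_div_cancel₀ _ ha, sq_le_sq.2 ?_⟩
      rwa [abs_div, div_le_iff₀' (abs_pos.2 ha), ← abs_mul]
  refine ⟨⟨!₂[1, 0, 0], ?_⟩, ⟨!₂[cos a, sin a, 0], ?_⟩,
    ⟨!₂[cos b, s, √(sin b ^ 2 - s ^ 2)], ?_⟩, ?_, ?_, ?_⟩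
  · simp [EuclideanSpace.norm_eq, Fin.sum_univ_three]
  · simp [EuclideanSpace.norm_eq, Fin.sum_univ_three]
  · rw [mem_sphere_zero_iff_norm, EuclideanSpace.norm_eq, sqrt_eq_one, Fin.sum_univ_three]
    simp only [Matrix.cons_val, norm_eq_abs, sq_abs, sq_sqrt (sub_nonneg.2 hsb)]
    linarith [sin_sq_add_cos_sq b]
  · simp [PiLp.inner_apply, Fin.sum_univ_three]
  · simp [PiLp.inner_apply, Fin.sum_univ_three]
  · simp [PiLp.inner_apply, Fin.sum_univ_three]
    linarith

end ModelSpace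

variable {M : Type*} [MetricSpace M] {κ : ℝ}

section Comparison

lemma IsGeodesic.apply_left {X : Type*} {δ : X → X → ℝ} {γ : unitInterval → X} {x y : X}
    (hγ : IsGeodesic δ γ x y) (t : unitInterval) : δ (γ t) x = δ x y * t := by
  have h := hγ.2.2 t 0
  rwa [hγ.1, Icc.coe_zero, sub_zero, abs_of_nonneg t.2.1] at h

lemma IsGeodesic.apply_right {X : Type*} {δ : X → X → ℝ} {γ : unitInterval → X} {x y : X}
    (hγ : IsGeodesic δ γ x y) (t : unitInterval) : δ (γ t) y = δ x y * (1 - t) := by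
  have h := hγ.2.2 t 1
  rwa [hγ.2.1, Icc.coe_one, abs_sub_comm, abs_of_nonneg (sub_nonneg.2 t.2.2)] at h

lemma two_mul_dist_le_sum (v : Fin 3 → M) (i : Fin 3) :
    2 * dist (v i) (v (i + 1)) ≤ ∑ j, dist (v j) (v (j + 1)) := by
  have h₀ := dist_triangle_right (v 0) (v 1) (v 2)
  have h₁ := dist_triangle_right (v 1) (v 2) (v 0)
  have h₂ := dist_triangle_right (v 2) (v 0) (v 1)
  simp only [Fin.sum_univ_three, dist_comm] at *
  fin_cases i <;> simp [dist_comm] at * <;> linarith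

lemma exists_comparison_vertices (hκ : 0 < κ) (v : Fin 3 → M)
    (hperim : ∑ i, dist (v i) (v (i + 1)) ≤ 2 * modelDiam κ) :
    ∃ w : Fin 3 → ModelSphere, ∀ i, dist (v i) (v (i + 1)) = modelDist κ (w i) (w (i + 1)) := by
  have hD (i : Fin 3) : dist (v i) (v (i + 1)) ∈ Icc 0 (modelDiam κ) :=
    ⟨dist_nonneg, by linarith [two_mul_dist_le_sum v i]⟩
  have hsub : |√κ * dist (v 0) (v 1) - √κ * dist (v 2) (v 0)| ≤ √κ * dist (v 1) (v 2) := by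
    rw [← mul_sub, abs_mul, abs_of_nonneg (sqrt_nonneg κ), dist_comm (v 0)]
    exact mul_le_mul_of_nonneg_left (abs_dist_sub_le _ _ _) (sqrt_nonneg κ)
  have hadd : √κ * dist (v 1) (v 2) ≤ √κ * dist (v 0) (v 1) + √κ * dist (v 2) (v 0) := by
    rw [← mul_add, dist_comm (v 0), dist_comm (v 2)]
    exact mul_le_mul_of_nonneg_left (dist_triangle _ _ _) (sqrt_nonneg κ)
  have hsum : √κ * dist (v 0) (v 1) + √κ * dist (v 2) (v 0) + √κ * dist (v 1) (v 2) ≤ 2 * π := by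
    rw [← mul_add, ← mul_add, ← sqrt_mul_modelDiam hκ, mul_left_comm, add_right_comm]
    rw [Fin.sum_univ_three] at hperim
    exact mul_le_mul_of_nonneg_left hperim (sqrt_nonneg κ)
  obtain ⟨w₀, w₁, w₂, h₀₁, h₀₂, h₁₂⟩ := exists_modelSphere_inner_eq_cos
    ((abs_cos_sub_cos_mul_cos_le hsub hadd hsum).trans (le_abs_self _))
  refine ⟨![w₀, w₁, w₂], fun i => (modelDist_eq_of_inner_eq hκ (hD i) ?_).symm⟩
  fin_cases i
  exacts [h₀₁, h₁₂, (real_inner_comm _ _).trans h₀₂]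

lemma exists_isComparisonTriangle (hκ : 0 < κ) (v : Fin 3 → M)
    (hperim : ∑ i, dist (v i) (v (i + 1)) < 2 * modelDiam κ) :
    ∃ w η, IsComparisonTriangle κ v w η ∧ ∀ i t,
      sin (√κ * dist (v i) (v (i + 1))) • (η i t).1 =
        sin ((1 - t) * (√κ * dist (v i) (v (i + 1)))) • (w i).1 +
          sin (t * (√κ * dist (v i) (v (i + 1)))) • (w (i + 1)).1 := by
  obtain ⟨w, hw⟩ := exists_comparison_vertices hκ v hperim.le
  have hside (i : Fin 3) : modelDist κ (w i) (w (i + 1)) < modelDiam κ := by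
    linarith [hw i, two_mul_dist_le_sum v i]
  choose η hη hslerp using fun i => exists_isGeodesic_modelDist hκ (hside i)
  exact ⟨w, η, ⟨hη, hw⟩, fun i t => by rw [hw i, hslerp]⟩

lemma IsCAT.cos_dist_geodesic_ge (hκ : 0 < κ) (hM : IsCAT κ M) {x y p : M}
    (hperim : dist x y + dist y p + dist p x < 2 * modelDiam κ) {γ : unitInterval → M}
    (hγ : IsGeodesic dist γ x y) (t : unitInterval) :
    sin ((1 - t) * (√κ * dist x y)) * cos (√κ * dist p x) +
        sin (t * (√κ * dist x y)) * cos (√κ * dist p y) ≤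
      sin (√κ * dist x y) * cos (√κ * dist p (γ t)) := by
  set v : Fin 3 → M := ![x, y, p]
  have hperim' : ∑ i, dist (v i) (v (i + 1)) < 2 * modelDiam κ := by
    rwa [Fin.sum_univ_three]
  have hside (i : Fin 3) : dist (v i) (v (i + 1)) < modelDiam κ := by
    linarith [two_mul_dist_le_sum v i]
  obtain ⟨γ₁, hγ₁⟩ := hM.exists_geodesic y p (hside 1)
  obtain ⟨γ₂, hγ₂⟩ := hM.exists_geodesic p x (hside 2)
  obtain ⟨w, η, hη, hslerp⟩ := exists_isComparisonTriangle hκ v hperim'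
  have hcat : dist (γ t) p ≤ modelDist κ (η 0 t) (w 2) := by
    refine hM.cat_inequality v ![γ, γ₁, γ₂] ?_ hperim' w η hη 0 2 (γ t) ⟨t, rfl⟩ p ⟨0, hγ₂.1⟩
      (η 0 t) ⟨t, rfl⟩ (w 2) ⟨0, (hη.1 2).1⟩ ?_ ?_
    · intro i
      fin_cases i
      exacts [hγ, hγ₁, hγ₂]
    · rw [(hη.1 0).apply_left, ← hη.2 0]
      exact hγ.apply_left t
    · rw [modelDist_self]
      exact dist_self p
  have hcos : ⟪(η 0 t).1, (w 2).1⟫ ≤ cos (√κ * dist p (γ t)) := by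
    rw [← cos_sqrt_mul_modelDist hκ, dist_comm p]
    have hD := modelDist_mem_Icc κ (η 0 t) (w 2)
    exact (strictAntiOn_cos_sqrt_mul hκ).antitoneOn ⟨dist_nonneg, hcat.trans hD.2⟩ hD hcat
  have hpx : cos (√κ * dist p x) = ⟪(w 0).1, (w 2).1⟫ := by
    rw [real_inner_comm, ← cos_sqrt_mul_modelDist hκ]
    exact congrArg (fun r => cos (√κ * r)) (hη.2 2)
  have hpy : cos (√κ * dist p y) = ⟪(w 1).1, (w 2).1⟫ := by
    rw [dist_comm, ← cos_sqrt_mul_modelDist hκ]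
    exact congrArg (fun r => cos (√κ * r)) (hη.2 1)
  have hsin : 0 ≤ sin (√κ * dist x y) := by
    refine sin_nonneg_of_nonneg_of_le_pi (by positivity) ?_
    rw [← sqrt_mul_modelDiam hκ]
    exact mul_le_mul_of_nonneg_left (hside 0).le (sqrt_nonneg κ)
  calc sin ((1 - t) * (√κ * dist x y)) * cos (√κ * dist p x) +
        sin (t * (√κ * dist x y)) * cos (√κ * dist p y)
    _ = ⟪sin (√κ * dist x y) • (η 0 t).1, (w 2).1⟫ := by
      rw [hpx, hpy, ← real_inner_smul_left, ← real_inner_smul_left, ← inner_add_left]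
      exact congrArg (⟪·, (w 2).1⟫) (hslerp 0 t).symm
    _ = sin (√κ * dist x y) * ⟪(η 0 t).1, (w 2).1⟫ := real_inner_smul_left _ _ _
    _ ≤ sin (√κ * dist x y) * cos (√κ * dist p (γ t)) := mul_le_mul_of_nonneg_left hcos hsin

lemma IsGeodesic.two_mul_dist_le {γ : unitInterval → M} {x y : M} (hγ : IsGeodesic dist γ x y)
    (p : M) (t : unitInterval) : 2 * dist p (γ t) ≤ dist x y + dist y p + dist p x := by
  have hx := hγ.apply_left t
  have hy := hγ.apply_right t
  have hpx := dist_triangle_right p (γ t) x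
  have hpy := dist_triangle_right p (γ t) y
  rw [dist_comm y p]
  linarith

lemma perimeter_lt_of_dist_lt {x y p : M} (hx : dist p x < modelDiam κ / 2)
    (hy : dist p y < modelDiam κ / 2) : dist x y + dist y p + dist p x < 2 * modelDiam κ := by
  linarith [dist_triangle_left x y p, dist_comm y p]

lemma IsCAT.cos_dist_add_cos_dist_le_midpoint (hκ : 0 < κ) (hM : IsCAT κ M) {x y p : M}
    (hperim : dist x y + dist y p + dist p x < 2 * modelDiam κ) {γ : unitInterval → M}
    (hγ : IsGeodesic dist γ x y) {t : unitInterval} (ht : (t : ℝ) = 1 / 2) :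
    cos (√κ * dist p x) + cos (√κ * dist p y) ≤
      2 * cos (√κ * (dist x y / 2)) * cos (√κ * dist p (γ t)) := by
  rcases eq_or_ne x y with rfl | hxy
  · have hγt : γ t = x := dist_eq_zero.1 (by rw [hγ.apply_left, dist_self, zero_mul])
    rw [hγt, dist_self, zero_div, mul_zero, cos_zero, mul_one, two_mul]
  set a := √κ * (dist x y / 2) with ha
  have hfull : √κ * dist x y = 2 * a := by rw [ha]; ring
  have ha₀ : 0 < a := mul_pos (sqrt_pos.2 hκ) (half_pos (dist_pos.2 hxy))
  have haπ : 2 * a < π := by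
    rw [← hfull, ← sqrt_mul_modelDiam hκ]
    refine mul_lt_mul_of_pos_left ?_ (sqrt_pos.2 hκ)
    linarith [dist_triangle_right x y p, dist_comm x p]
  have hsin : 0 < sin a := sin_pos_of_pos_of_lt_pi ha₀ (by linarith)
  have hleft : (1 - (t : ℝ)) * (2 * a) = a := by rw [ht]; ring
  have hright : (t : ℝ) * (2 * a) = a := by rw [ht]; ring
  have hmid := hM.cos_dist_geodesic_ge hκ hperim hγ t
  rw [hfull, hleft, hright, sin_two_mul] at hmid
  refine le_of_mul_le_mul_left ?_ hsin
  linarith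

end Comparison

section NearestPoint

variable {C : Set M} {x y z p c : M}

lemma cos_sqrt_mul_dist_le_cos_sqrt_mul_infDist (hκ : 0 < κ) (hy : y ∈ C)
    (hxy : dist x y ≤ modelDiam κ) : cos (√κ * dist x y) ≤ cos (√κ * Metric.infDist x C) :=
  have hle : Metric.infDist x C ≤ dist x y := Metric.infDist_le_dist_of_mem hy
  (strictAntiOn_cos_sqrt_mul hκ).antitoneOn ⟨Metric.infDist_nonneg, hle.trans hxy⟩
    ⟨dist_nonneg, hxy⟩ hle

lemma cos_sqrt_mul_infDist_pos (hκ : 0 < κ) (hy : y ∈ C) (hxy : dist x y < modelDiam κ / 2) :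
    0 < cos (√κ * Metric.infDist x C) :=
  cos_sqrt_mul_pos hκ Metric.infDist_nonneg ((Metric.infDist_le_dist_of_mem hy).trans_lt hxy)

lemma IsCAT.cos_dist_add_cos_dist_le_infDist (hκ : 0 < κ) (hM : IsCAT κ M)
    (hC : IsGeodesicallyConvex C) (hy : y ∈ C) (hz : z ∈ C)
    (hperim : dist y z + dist z x + dist x y < 2 * modelDiam κ) :
    cos (√κ * dist x y) + cos (√κ * dist x z) ≤
      2 * cos (√κ * (dist y z / 2)) * cos (√κ * Metric.infDist x C) := by
  obtain ⟨⟨γ, hγ⟩, hγC⟩ := hC y hy z hz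
  let t : unitInterval := ⟨1 / 2, by norm_num, by norm_num⟩
  refine (hM.cos_dist_add_cos_dist_le_midpoint hκ hperim hγ (t := t) rfl).trans ?_
  have hyz : dist y z < modelDiam κ := by
    linarith [dist_triangle_right y z x, dist_comm x y]
  have hcos : 0 < cos (√κ * (dist y z / 2)) :=
    cos_sqrt_mul_pos hκ (by positivity) (by linarith)
  gcongr
  exact cos_sqrt_mul_dist_le_cos_sqrt_mul_infDist hκ (hγC γ hγ ⟨t, rfl⟩)
    (by linarith [hγ.two_mul_dist_le x t])

lemma IsCAT.eq_of_isNearestPoint (hκ : 0 < κ) (hM : IsCAT κ M) (hC : IsGeodesicallyConvex C)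
    (hx : Metric.infDist x C < modelDiam κ / 2) (hy : IsNearestPoint C x y)
    (hz : IsNearestPoint C x z) : y = z := by
  have hxy := hy.2.trans_lt hx
  have hxz := hz.2.trans_lt hx
  have hmid := hM.cos_dist_add_cos_dist_le_infDist hκ hC hy.1 hz.1 (perimeter_lt_of_dist_lt hxy hxz)
  rw [hy.2, hz.2] at hmid
  have hpos := cos_sqrt_mul_infDist_pos hκ hy.1 hxy
  by_contra hne
  have hlt : cos (√κ * (dist y z / 2)) < 1 := by
    rw [← cos_zero, ← mul_zero √κ]
    have hhalf : 0 < dist y z / 2 := half_pos (dist_pos.2 hne)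
    have hle : dist y z / 2 ≤ modelDiam κ := by linarith [dist_triangle_left y z x]
    exact strictAntiOn_cos_sqrt_mul hκ ⟨le_rfl, hhalf.le.trans hle⟩ ⟨hhalf.le, hle⟩ hhalf
  nlinarith

lemma IsCAT.cauchySeq_of_tendsto_infDist (hκ : 0 < κ) (hM : IsCAT κ M)
    (hC : IsGeodesicallyConvex C) {u : ℕ → M} (huC : ∀ n, u n ∈ C)
    (hu : ∀ n, dist x (u n) < modelDiam κ / 2)
    (hlim : Tendsto (fun n => dist x (u n)) atTop (𝓝 (Metric.infDist x C))) : CauchySeq u := by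
  set S := cos (√κ * Metric.infDist x C)
  have hS : 0 < S := cos_sqrt_mul_infDist_pos hκ (huC 0) (hu 0)
  have hcos : Tendsto (fun n => cos (√κ * dist x (u n))) atTop (𝓝 S) :=
    (continuous_cos.tendsto _).comp (hlim.const_mul _)
  have hlower : Tendsto
      (fun m : ℕ × ℕ => (cos (√κ * dist x (u m.1)) + cos (√κ * dist x (u m.2))) / (2 * S))
      atTop (𝓝 1) := by
    rw [← prod_atTop_atTop_eq]
    have := ((hcos.comp tendsto_fst).add (hcos.comp tendsto_snd)).div_const (2 * S)
    rwa [← two_mul, div_self (by positivity)] at this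
  have hhalf : Tendsto (fun m : ℕ × ℕ => dist (u m.1) (u m.2) / 2) atTop (𝓝 0) := by
    refine tendsto_zero_of_tendsto_cos_sqrt_mul hκ (fun m => ⟨by positivity, ?_⟩) <|
      tendsto_of_tendsto_of_tendsto_of_le_of_le hlower tendsto_const_nhds (fun m => ?_)
        fun m => cos_le_one _
    · linarith [dist_triangle_left (u m.1) (u m.2) x, hu m.1, hu m.2, modelDiam_pos hκ]
    · rw [div_le_iff₀ (by positivity)]
      linarith [hM.cos_dist_add_cos_dist_le_infDist hκ hC (huC m.1) (huC m.2)
        (perimeter_lt_of_dist_lt (hu m.1) (hu m.2))]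
  rw [cauchySeq_iff_tendsto_dist_atTop_0]
  simpa using hhalf.mul_const 2

lemma exists_seq_tendsto_infDist (hC : C.Nonempty) (x : M) :
    ∃ u : ℕ → M, (∀ n, u n ∈ C) ∧
      Tendsto (fun n => dist x (u n)) atTop (𝓝 (Metric.infDist x C)) := by
  have hex (n : ℕ) : ∃ c ∈ C, dist x c < Metric.infDist x C + 1 / ((n : ℝ) + 1) :=
    (Metric.infDist_lt_iff hC).1 (lt_add_of_pos_right _ Nat.one_div_pos_of_nat)
  choose u huC hu using hex
  refine ⟨u, huC, tendsto_of_tendsto_of_tendsto_of_le_of_le tendsto_const_nhds ?_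
    (fun n => Metric.infDist_le_dist_of_mem (huC n)) fun n => (hu n).le⟩
  simpa using tendsto_one_div_add_atTop_nhds_zero_nat.const_add (Metric.infDist x C)

lemma IsCAT.exists_isNearestPoint (hκ : 0 < κ) (hM : IsCAT κ M) (hC : IsGeodesicallyConvex C)
    (hcomplete : IsComplete C) (hne : C.Nonempty) (hx : Metric.infDist x C < modelDiam κ / 2) :
    ∃ p, IsNearestPoint C x p := by
  obtain ⟨u, huC, hu⟩ := exists_seq_tendsto_infDist hne x
  obtain ⟨N, hN⟩ := eventually_atTop.1 (hu.eventually_lt_const hx)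
  have htail : Tendsto (fun n => dist x (u (n + N))) atTop (𝓝 (Metric.infDist x C)) :=
    hu.comp (tendsto_add_atTop_nat N)
  have hcauchy : CauchySeq fun n => u (n + N) :=
    hM.cauchySeq_of_tendsto_infDist hκ hC (fun n => huC _) (fun n => hN _ (by omega)) htail
  obtain ⟨p, hpC, hp⟩ := cauchySeq_tendsto_of_isComplete hcomplete (fun n => huC _) hcauchy
  exact ⟨p, hpC, tendsto_nhds_unique (tendsto_const_nhds.dist hp) htail⟩

lemma IsCAT.isNearestPoint_metricProj (hκ : 0 < κ) (hM : IsCAT κ M) (hC : IsGeodesicallyConvex C)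
    (hcomplete : IsComplete C) (hne : C.Nonempty) (hx : Metric.infDist x C < modelDiam κ / 2) :
    IsNearestPoint C x (metricProj C x) := by
  obtain ⟨p, hp⟩ := hM.exists_isNearestPoint hκ hC hcomplete hne hx
  have hunique : ∃! p, IsNearestPoint C x p :=
    ⟨p, hp, fun q hq => hM.eq_of_isNearestPoint hκ hC hx hq hp⟩
  rw [metricProj, dif_pos hunique]
  exact hunique.choose_spec.1

lemma le_mul_cos_of_forall_sin_add_sin_le {a X P : ℝ} (ha₀ : 0 < a) (haπ : a < π)
    (h : ∀ t ∈ Ioc (0 : ℝ) 1, sin ((1 - t) * a) * P + sin (t * a) * X ≤ sin a * P) :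
    X ≤ P * cos a := by
  -- Both `sin a - sin ((1 - t) * a)` and `sin (t * a)` have the factor `2 * sin (t * a / 2)`.
  have hhalf : ∀ t ∈ Ioc (0 : ℝ) 1, X * cos (t * a / 2) ≤ P * cos (a - t * a / 2) := by
    intro t ht
    have hta : 0 < t * a := mul_pos ht.1 ha₀
    have hsin : 0 < 2 * sin (t * a / 2) :=
      mul_pos two_pos <| sin_pos_of_pos_of_lt_pi (by linarith) (by nlinarith [ht.2])
    have hdiff : sin a - sin ((1 - t) * a) = 2 * sin (t * a / 2) * cos (a - t * a / 2) := by
      rw [sin_sub_sin]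
      ring_nf
    have hdouble : sin (t * a) = 2 * sin (t * a / 2) * cos (t * a / 2) := by
      rw [← sin_two_mul]
      ring_nf
    refine le_of_mul_le_mul_left ?_ hsin
    linear_combination h t ht - X * hdouble + P * hdiff
  have hleft : Tendsto (fun t => X * cos (t * a / 2)) (𝓝[>] 0) (𝓝 X) :=
    tendsto_nhdsWithin_of_tendsto_nhds (Continuous.tendsto' (by fun_prop) _ _ (by simp))
  have hright : Tendsto (fun t => P * cos (a - t * a / 2)) (𝓝[>] 0) (𝓝 (P * cos a)) :=
    tendsto_nhdsWithin_of_tendsto_nhds (Continuous.tendsto' (by fun_prop) _ _ (by simp))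
  exact le_of_tendsto_of_tendsto hleft hright <|
    eventually_of_mem (Ioc_mem_nhdsGT zero_lt_one) hhalf

lemma IsCAT.cos_dist_le_mul_of_isNearestPoint (hκ : 0 < κ) (hM : IsCAT κ M)
    (hC : IsGeodesicallyConvex C) (hp : IsNearestPoint C x p) (hz : z ∈ C)
    (hperim : dist p z + dist z x + dist x p < 2 * modelDiam κ) :
    cos (√κ * dist x z) ≤ cos (√κ * dist x p) * cos (√κ * dist p z) := by
  rcases eq_or_ne p z with rfl | hpz
  · simp
  obtain ⟨⟨γ, hγ⟩, hγC⟩ := hC p hp.1 z hz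
  have hpos : 0 < √κ * dist p z := mul_pos (sqrt_pos.2 hκ) (dist_pos.2 hpz)
  have hlt : √κ * dist p z < π := by
    rw [← sqrt_mul_modelDiam hκ]
    refine mul_lt_mul_of_pos_left ?_ (sqrt_pos.2 hκ)
    linarith [dist_triangle_right p z x, dist_comm x p]
  refine le_mul_cos_of_forall_sin_add_sin_le hpos hlt fun t ht => ?_
  let s : unitInterval := ⟨t, ht.1.le, ht.2⟩
  have hnear : cos (√κ * dist x (γ s)) ≤ cos (√κ * dist x p) := by
    rw [hp.2]
    exact cos_sqrt_mul_dist_le_cos_sqrt_mul_infDist hκ (hγC γ hγ ⟨s, rfl⟩)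
      (by linarith [hγ.two_mul_dist_le x s])
  exact (hM.cos_dist_geodesic_ge hκ hperim hγ s).trans <|
    mul_le_mul_of_nonneg_left hnear (sin_nonneg_of_nonneg_of_le_pi hpos.le hlt.le)

lemma IsNearestPoint.dist_le (hp : IsNearestPoint C x p) (hz : z ∈ C) : dist x p ≤ dist x z :=
  hp.2.trans_le (Metric.infDist_le_dist_of_mem hz)

lemma IsCAT.cos_dist_le_mul_of_isNearestPoint_of_dist_lt (hκ : 0 < κ) (hM : IsCAT κ M)
    (hC : IsGeodesicallyConvex C) (hp : IsNearestPoint C x p) (hz : z ∈ C)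
    (hxz : dist x z < modelDiam κ / 2) :
    cos (√κ * dist x z) ≤ cos (√κ * dist x p) * cos (√κ * dist p z) :=
  hM.cos_dist_le_mul_of_isNearestPoint hκ hC hp hz <|
    perimeter_lt_of_dist_lt ((hp.dist_le hz).trans_lt hxz) hxz

lemma IsCAT.dist_le_of_isNearestPoint (hκ : 0 < κ) (hM : IsCAT κ M)
    (hC : IsGeodesicallyConvex C) (hp : IsNearestPoint C x p) (hz : z ∈ C)
    (hxz : dist x z < modelDiam κ / 2) : dist p z ≤ dist x z := by
  have hxp : dist x p < modelDiam κ / 2 := (hp.dist_le hz).trans_lt hxz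
  have hpz : dist p z ≤ modelDiam κ := by linarith [dist_triangle_left p z x]
  have hxz' : dist x z ≤ modelDiam κ := by linarith [dist_nonneg (x := x) (y := z)]
  have hpyth := hM.cos_dist_le_mul_of_isNearestPoint_of_dist_lt hκ hC hp hz hxz
  have hcos_xz : 0 < cos (√κ * dist x z) := cos_sqrt_mul_pos hκ dist_nonneg hxz
  have hcos_pz : 0 < cos (√κ * dist p z) :=
    pos_of_mul_pos_right (hcos_xz.trans_le hpyth) (cos_sqrt_mul_pos hκ dist_nonneg hxp).le
  exact ((strictAntiOn_cos_sqrt_mul hκ).le_iff_ge ⟨dist_nonneg, hxz'⟩ ⟨dist_nonneg, hpz⟩).1 <|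
    hpyth.trans (mul_le_of_le_one_left hcos_pz.le (cos_le_one _))

end NearestPoint

section ProjectionSequence

/-- A sequence of successive projections: `u (n + 1)` is a point of `C n` nearest to `u n`. It is
phrased with nearest points so that it does not depend on the default value of `metricProj`. -/
def IsProjectionSequence (C : ℕ → Set M) (u : ℕ → M) : Prop :=
  ∀ n, IsNearestPoint (C n) (u n) (u (n + 1))

variable {C : ℕ → Set M} {u : ℕ → M} {z : M}

lemma IsProjectionSequence.eventually_mem_or_mem_succ (hu : IsProjectionSequence C u) {S : Set M}
    (hS : ∀ n, C n = S ∨ C (n + 1) = S) : ∀ᶠ n in atTop, u n ∈ S ∨ u (n + 1) ∈ S := by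
  refine eventually_atTop.2 ⟨1, fun n hn => ?_⟩
  obtain ⟨k, rfl⟩ := Nat.exists_eq_add_of_le' hn
  rcases hS k with h | h
  · exact Or.inl (h ▸ (hu k).1)
  · exact Or.inr (h ▸ (hu (k + 1)).1)

lemma IsProjectionSequence.antitone_dist (hu : IsProjectionSequence C u) (hκ : 0 < κ)
    (hM : IsCAT κ M) (hC : ∀ n, IsGeodesicallyConvex (C n)) (hz : ∀ n, z ∈ C n)
    (hu₀ : dist (u 0) z < modelDiam κ / 2) : Antitone fun n => dist (u n) z := by
  have hstep (n : ℕ) (hn : dist (u n) z < modelDiam κ / 2) : dist (u (n + 1)) z ≤ dist (u n) z :=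
    hM.dist_le_of_isNearestPoint hκ (hC n) (hu n) (hz n) hn
  have hlt (n : ℕ) : dist (u n) z < modelDiam κ / 2 := by
    induction n with
    | zero => exact hu₀
    | succ n ih => exact (hstep n ih).trans_lt ih
  exact antitone_nat_of_succ_le fun n => hstep n (hlt n)

lemma IsProjectionSequence.tendsto_of_mapClusterPt (hu : IsProjectionSequence C u) (hκ : 0 < κ)
    (hM : IsCAT κ M) (hC : ∀ n, IsGeodesicallyConvex (C n)) (hz : ∀ n, z ∈ C n)
    (hcluster : MapClusterPt z atTop u) : Tendsto u atTop (𝓝 z) := by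
  refine Metric.tendsto_atTop.2 fun ε hε => ?_
  have hδ : 0 < min ε (modelDiam κ / 2) := lt_min hε (half_pos (modelDiam_pos hκ))
  obtain ⟨N, hN⟩ := (hcluster.frequently (Metric.ball_mem_nhds z hδ)).exists
  have hshift : IsProjectionSequence (fun n => C (N + n)) fun n => u (N + n) := fun n => hu (N + n)
  have hanti := hshift.antitone_dist hκ hM (fun n => hC _) (fun n => hz _)
    (hN.trans_le (min_le_right _ _))
  refine ⟨N, fun n hn => ?_⟩
  obtain ⟨k, rfl⟩ := Nat.exists_eq_add_of_le hn
  exact (hanti k.zero_le).trans_lt (hN.trans_le (min_le_left _ _))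

lemma tendsto_one_of_le_mul_succ {q r : ℕ → ℝ} (hq : ∀ n, 0 < q n) (hbdd : BddAbove (range q))
    (hr : ∀ n, r n ≤ 1) (h : ∀ n, q n ≤ r n * q (n + 1)) : Tendsto r atTop (𝓝 1) := by
  have hmono : Monotone q := monotone_nat_of_le_succ fun n =>
    (h n).trans (mul_le_of_le_one_left (hq (n + 1)).le (hr n))
  have hlim : Tendsto q atTop (𝓝 (⨆ n, q n)) := tendsto_atTop_ciSup hmono hbdd
  have hsup : ⨆ n, q n ≠ 0 := ((hq 0).trans_le (le_ciSup hbdd 0)).ne'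
  have hquot := hlim.div (hlim.comp (tendsto_add_atTop_nat 1)) hsup
  rw [div_self hsup] at hquot
  exact tendsto_of_tendsto_of_tendsto_of_le_of_le hquot tendsto_const_nhds
    (fun n => (div_le_iff₀ (hq (n + 1))).2 (h n)) hr

lemma IsProjectionSequence.tendsto_dist_succ (hu : IsProjectionSequence C u) (hκ : 0 < κ)
    (hM : IsCAT κ M) (hC : ∀ n, IsGeodesicallyConvex (C n)) (hz : ∀ n, z ∈ C n)
    (hu₀ : dist (u 0) z < modelDiam κ / 2) :
    Tendsto (fun n => dist (u n) (u (n + 1))) atTop (𝓝 0) := by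
  have hlt (n : ℕ) : dist (u n) z < modelDiam κ / 2 :=
    (hu.antitone_dist hκ hM hC hz hu₀ n.zero_le).trans_lt hu₀
  have hle (n : ℕ) : dist (u n) (u (n + 1)) ≤ modelDiam κ := by
    linarith [(hu n).dist_le (hz n), hlt n, modelDiam_pos hκ]
  refine tendsto_zero_of_tendsto_cos_sqrt_mul hκ (fun n => ⟨dist_nonneg, hle n⟩) ?_
  exact tendsto_one_of_le_mul_succ (q := fun n => cos (√κ * dist (u n) z))
    (fun n => cos_sqrt_mul_pos hκ dist_nonneg (hlt n))
    ⟨1, forall_mem_range.2 fun n => cos_le_one _⟩ (fun n => cos_le_one _) fun n =>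
      hM.cos_dist_le_mul_of_isNearestPoint_of_dist_lt hκ (hC n) (hu n) (hz n) (hlt n)

end ProjectionSequence

section AlternatingProjections

variable {A B : Set M} {x₀ z : M}

lemma isProjectionSequence_altProj (hκ : 0 < κ) (hM : IsCAT κ M) (hA : IsComplete A)
    (hB : IsComplete B) (hAconvex : IsGeodesicallyConvex A) (hBconvex : IsGeodesicallyConvex B)
    (hz : z ∈ A ∩ B) (hx₀ : dist x₀ z < modelDiam κ / 2) :
    IsProjectionSequence (fun n => if Even n then A else B) (altProj A B x₀) := by
  have hproj {C : Set M} (hC : IsComplete C) (hconvex : IsGeodesicallyConvex C) (hzC : z ∈ C)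
      {x : M} (hx : dist x z < modelDiam κ / 2) :
      IsNearestPoint C x (metricProj C x) ∧ dist (metricProj C x) z < modelDiam κ / 2 := by
    have hnear := hM.isNearestPoint_metricProj hκ hconvex hC ⟨z, hzC⟩
      ((Metric.infDist_le_dist_of_mem hzC).trans_lt hx)
    exact ⟨hnear, (hM.dist_le_of_isNearestPoint hκ hconvex hnear hzC hx).trans_lt hx⟩
  have hstep (n : ℕ) (hn : dist (altProj A B x₀ n) z < modelDiam κ / 2) :
      IsNearestPoint (if Even n then A else B) (altProj A B x₀ n) (altProj A B x₀ (n + 1)) ∧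
        dist (altProj A B x₀ (n + 1)) z < modelDiam κ / 2 := by
    rw [altProj]
    split_ifs
    · exact hproj hA hAconvex hz.1 hn
    · exact hproj hB hBconvex hz.2 hn
  have hlt (n : ℕ) : dist (altProj A B x₀ n) z < modelDiam κ / 2 := by
    induction n with
    | zero => exact hx₀
    | succ n ih => exact (hstep n ih).2
  exact fun n => (hstep n (hlt n)).1

lemma BoundedlyCompact.isCompact_inter_closedBall {S : Set M} (hS : BoundedlyCompact S) (z : M)
    (r : ℝ) : IsCompact (S ∩ Metric.closedBall z r) := by
  rw [← Subtype.image_preimage_coe]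
  refine (hS _ ?_ (Metric.isClosed_closedBall.preimage continuous_subtype_val)).image
    continuous_subtype_val
  exact Bornology.isBounded_induced.2 <|
    Metric.isBounded_closedBall.subset (image_preimage_subset _ _)

lemma BoundedlyCompact.exists_mapClusterPt {S : Set M} (hS : BoundedlyCompact S) {ι : Type*}
    {l : Filter ι} {u : ι → M} {r : ℝ} (hu : ∀ i, dist (u i) z ≤ r) (huS : ∃ᶠ i in l, u i ∈ S) :
    ∃ x, MapClusterPt x l u := by
  obtain ⟨x, -, hx⟩ := (hS.isCompact_inter_closedBall z r).exists_mapClusterPt_of_frequently <|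
    huS.mono fun i hi => ⟨hi, hu i⟩
  exact ⟨x, hx⟩

lemma frequently_of_eventually_or_succ {p : ℕ → Prop} (h : ∀ᶠ n in atTop, p n ∨ p (n + 1)) :
    ∃ᶠ n in atTop, p n := by
  intro hp
  obtain ⟨n, hn, hn₀, hn₁⟩ :=
    (h.and (hp.and ((tendsto_add_atTop_nat 1).eventually hp))).exists
  exact hn.elim hn₀ hn₁

lemma mem_of_mapClusterPt_of_tendsto_dist_succ {X : Type*} [PseudoMetricSpace X] {S : Set X}
    (hS : IsClosed S) {u : ℕ → X} (huS : ∀ᶠ n in atTop, u n ∈ S ∨ u (n + 1) ∈ S)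
    (hstep : Tendsto (fun n => dist (u n) (u (n + 1))) atTop (𝓝 0)) {x : X}
    (hx : MapClusterPt x atTop u) : x ∈ S := by
  rw [← hS.closure_eq]
  refine Metric.mem_closure_iff.2 fun ε hε => ?_
  obtain ⟨n, hux, hstep_lt, huS | huS⟩ := ((hx.frequently (Metric.ball_mem_nhds x (half_pos hε)))
    |>.and_eventually ((hstep.eventually_lt_const (half_pos hε)).and huS)).exists
  · exact ⟨u n, huS, by linarith [Metric.mem_ball'.1 hux]⟩
  · exact ⟨u (n + 1), huS, by
      linarith [Metric.mem_ball'.1 hux, dist_triangle x (u n) (u (n + 1))]⟩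

lemma dist_lt_of_ediam_univ_lt {X : Type*} [PseudoMetricSpace X] {r : ℝ}
    (h : Metric.ediam (univ : Set X) < ENNReal.ofReal r) (x y : X) : dist x y < r := by
  have hxy := (Metric.edist_le_ediam_of_mem (mem_univ x) (mem_univ y)).trans_lt h
  rwa [edist_dist, ENNReal.ofReal_lt_ofReal_iff_of_nonneg dist_nonneg] at hxy

end AlternatingProjections

end CATSpace

open CATSpace Filter in
theorem corollary3p8_general {M : Type*} [MetricSpace M] {κ : ℝ} (hκ : 0 < κ) (hM : IsCAT κ M)
    {A B : Set M} (hA : IsComplete A) (hB : IsComplete B)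
    (hAconvex : IsGeodesicallyConvex A) (hBconvex : IsGeodesicallyConvex B)
    (hcompact : BoundedlyCompact A ∨ BoundedlyCompact B) {x₀ z : M} (hz : z ∈ A ∩ B)
    (hx₀ : dist x₀ z < modelDiam κ / 2) :
    ∃ x ∈ A ∩ B, Tendsto (altProj A B x₀) atTop (nhds x) := by
  have hu := isProjectionSequence_altProj hκ hM hA hB hAconvex hBconvex hz hx₀
  have hconvex (n : ℕ) : IsGeodesicallyConvex (if Even n then A else B) :=
    iteInduction (fun _ => hAconvex) fun _ => hBconvex
  have hmem {x : M} (hx : x ∈ A ∩ B) (n : ℕ) : x ∈ if Even n then A else B :=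
    iteInduction (motive := (x ∈ ·)) (fun _ => hx.1) fun _ => hx.2
  have hanti := hu.antitone_dist hκ hM hconvex (hmem hz) hx₀
  have hstep := hu.tendsto_dist_succ hκ hM hconvex (hmem hz) hx₀
  have huA := hu.eventually_mem_or_mem_succ (S := A) fun n => by grind
  have huB := hu.eventually_mem_or_mem_succ (S := B) fun n => by grind
  obtain ⟨x, hx⟩ : ∃ x, MapClusterPt x atTop (altProj A B x₀) :=
    hcompact.elim
      (·.exists_mapClusterPt (fun n => hanti n.zero_le) (frequently_of_eventually_or_succ huA))
      (·.exists_mapClusterPt (fun n => hanti n.zero_le) (frequently_of_eventually_or_succ huB))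
  have hxAB : x ∈ A ∩ B :=
    ⟨mem_of_mapClusterPt_of_tendsto_dist_succ hA.isClosed huA hstep hx,
      mem_of_mapClusterPt_of_tendsto_dist_succ hB.isClosed huB hstep hx⟩
  exact ⟨x, hxAB, hu.tendsto_of_mapClusterPt hκ hM hconvex (hmem hxAB) hx⟩

theorem corollary3p8 {M : Type*} [MetricSpace M] [CompleteSpace M] (κ : ℝ) (hκ : 0 < κ)
    (hM : CATSpace.IsCAT κ M)
    (hdiam : Metric.ediam (Set.univ : Set M) < ENNReal.ofReal (CATSpace.modelDiam κ / 2))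
    (A B : Set M) (hAclosed : IsClosed A) (hBclosed : IsClosed B)
    (hAconvex : CATSpace.IsGeodesicallyConvex A) (hBconvex : CATSpace.IsGeodesicallyConvex B)
    (hAB : (A ∩ B).Nonempty)
    (hcompact : CATSpace.BoundedlyCompact A ∨ CATSpace.BoundedlyCompact B) (x₀ : M) :
    ∃ x ∈ A ∩ B, Filter.Tendsto (CATSpace.altProj A B x₀) Filter.atTop (nhds x) := by
  obtain ⟨z, hz⟩ := hAB
  exact corollary3p8_general hκ hM hAclosed.isComplete hBclosed.isComplete hAconvex hBconvex
    hcompact hz (CATSpace.dist_lt_of_ediam_univ_lt hdiam x₀ z)
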